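/- Conventions. All rings are commutative with $1$. An iterative derivation on a ring $R$ is a ring homomorphism $\theta:R\to R[[T]]$, $\theta(r)=\sum_{i\ge 0}\theta^{(i)}(r)T^i$, with $\theta^{(0)}=\mathrm{id}_R$ and $\theta^{(i)}\circ\theta^{(j)}=\binom{i+j}{i}\theta^{(i+j)}$ for all $i,j\ge 0$; then $(R,\theta)$ is an ID-ring, with ring of constants $C_R=\{r\in R:\theta(r)=r\}$. An ideal $I$ is an ID-ideal if $\theta(I)\subseteq I[[T]]$, and $R\neq 0$ is ID-simple if its only ID-ideals are $0$ and $R$. If $R$ is an ID-ring containing a field $C$ of constants and $D$ is a $C$-algebra, then $R\otimes_C D$ carries the iterative derivation $\theta^{(k)}(r\otimes d)=\theta^{(k)}(r)\otimes d$. Let $(F,\theta)$ be an ID-field of characteristic $p>0$ whose field of constants $C=C_F$ is perfect, with $\theta^{(1)}\neq 0$. Let $A=\sum_k A_kT^k\in \mathrm{GL}_n(F[[T]])$ satisfy $A_0=1$ and $\binom{k+l}{l}A_{k+l}=\sum_{i+j=l}\theta^{(i)}(A_k)A_j$ for all $k,l\geq 0$. A PV-ring over $F$ for the equation $\theta(y)=Ay$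 is an ID-simple ID-ring $R$ extending $(F,\theta)$, with $C_R=C$, for which there is $Y\in \mathrm{GL}_n(R)$ with $\theta(Y)=AY$ such that the entries of $Y$ together with $\det(Y)^{-1}$ generate $R$ as an $F$-algebra. Such an $R$ is a domain; its fraction field $E$ is called a PV-extension of $F$. The Galois group scheme $\mathcal G$ of $E/F$ is the affine group scheme over $C$ representing the functor $D\mapsto \mathrm{Aut}^{ID}(R\otimes_C D/F\otimes_C D)$ from $C$-algebras to groups, which sends $D$ to the group of all $(F\otimes_C D)$-algebra automorphisms of $R\otimes_C D$ commuting with the iterative derivation. Lemma. Let $E/F$ be a PV-extension as above, with PV-ring $R$ and Galois group scheme $\mathcal G$, and assume that $E/F$ is finite and separable. Let $\bar C$ be an algebraic closure of $C$, and put $F_{\bar C}=F\otimes_C\bar C$, $E_{\bar C}=E\otimes_C\bar C$. Then $F_{\bar C}$ and $E_{\bar C}$ are fields, $E_{\bar C}/F_{\bar C}$ is a finite Galois extension in the classical sense, and its Galois group is $\mathcal G(\bar C)$: there is an isomorphism of groups $\mathcal G(\bar C)=\mathrm{Aut}^{ID}(R\otimes_C\bar C/F\otimes_C\bar C)\cong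 \mathrm{Gal}(E_{\bar C}/F_{\bar C})$ sending each $\sigma\in\mathcal G(\bar C)$ to an automorphism of $E_{\bar C}$ that is compatible with $\sigma$ along $R\otimes_C\bar C\to E_{\bar C}$. -/

import Mathlib

open scoped TensorProduct PowerSeries Matrix

universe w

noncomputable section

/-- An iterative derivation on the ring `R`, trivial on the base ring `C`: a ring homomorphism
`θ : R → R⟦T⟧`, `θ r = ∑ θ⁽ⁱ⁾(r) Tⁱ`, such that `θ⁽⁰⁾ = id`, `θ⁽ⁱ⁾ ∘ θ⁽ʲ⁾ = (i+j choose i) θ⁽ⁱ⁺ʲ⁾`,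
and such that the image of `C` in `R` consists of constants (this is the `C`-linearity of `θ`). -/
structure IterativeDerivation (C R : Type*) [CommRing C] [CommRing R] [Algebra C R] where
  /-- The homomorphism `R → R⟦T⟧`. -/
  toAlgHom : R →ₐ[C] R⟦X⟧
  coeff_zero' : ∀ r, PowerSeries.coeff 0 (toAlgHom r) = r
  coeff_coeff' : ∀ i j r, PowerSeries.coeff i (toAlgHom (PowerSeries.coeff j (toAlgHom r))) =
    (i + j).choose i • PowerSeries.coeff (i + j) (toAlgHom r)

namespace IterativeDerivation

section Basic

variable {C R : Type*} [CommRing C] [CommRing R] [Algebra C R] (θ : IterativeDerivation C R)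

/-- The map `θ⁽ⁱ⁾ : R → R`. -/
def D (i : ℕ) (r : R) : R := PowerSeries.coeff i (θ.toAlgHom r)

/-- `r` is a constant: `θ(r) = r`. -/
def IsConstant (r : R) : Prop := θ.toAlgHom r = PowerSeries.C r

/-- The ring of constants of `(R, θ)` is the (image of the) base ring `C`. -/
def ConstantsEqBase : Prop := ∀ r : R, θ.IsConstant r ↔ r ∈ (algebraMap C R).range

/-- `θ⁽¹⁾ ≠ 0`. -/
def NonDegenerate : Prop := ∃ r : R, θ.D 1 r ≠ 0

/-- `I` is an ID-ideal: `θ(I) ⊆ I⟦T⟧`. -/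
def IsIDIdeal (I : Ideal R) : Prop := ∀ r ∈ I, ∀ i, θ.D i r ∈ I

/-- `R` is a nonzero ring without proper nontrivial ID-ideals. -/
def IsIDSimple : Prop := Nontrivial R ∧ ∀ I : Ideal R, θ.IsIDIdeal I → I = ⊥ ∨ I = ⊤

/-- The homomorphism `θ : R ⊗ D → (R ⊗ D)⟦T⟧` extending `θ` on `R` and the trivial iterative
derivation `d ↦ d` on `D`. -/
def baseChangeHom (D : Type*) [CommRing D] [Algebra C D] : R ⊗[C] D →ₐ[C] (R ⊗[C] D)⟦X⟧ :=
  Algebra.TensorProduct.lift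
    ((PowerSeries.mapAlgHom (Algebra.TensorProduct.includeLeft : R →ₐ[C] R ⊗[C] D)).comp
      θ.toAlgHom)
    ((IsScalarTower.toAlgHom C (R ⊗[C] D) (R ⊗[C] D)⟦X⟧).comp
      (Algebra.TensorProduct.includeRight : D →ₐ[C] R ⊗[C] D))
    (fun _ _ => mul_comm _ _)

theorem coeff_baseChangeHom_tmul (D : Type*) [CommRing D] [Algebra C D] (k : ℕ) (r : R) (d : D) :
    PowerSeries.coeff k (θ.baseChangeHom D (r ⊗ₜ d)) = θ.D k r ⊗ₜ[C] d := by
  have h : θ.baseChangeHom D (r ⊗ₜ d) =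
      PowerSeries.map (Algebra.TensorProduct.includeLeft : R →ₐ[C] R ⊗[C] D).toRingHom
        (θ.toAlgHom r) * PowerSeries.C ((1 : R) ⊗ₜ[C] d) := by
    rw [baseChangeHom]
    exact Algebra.TensorProduct.lift_tmul ..
  rw [h, PowerSeries.coeff_mul_C, PowerSeries.coeff_map]
  simp [IterativeDerivation.D]

/-- The extension of an iterative derivation to `R ⊗ D`, where `D` carries the trivial iterative
derivation: `θ⁽ᵏ⁾(r ⊗ d) = θ⁽ᵏ⁾(r) ⊗ d`. -/
def baseChange (D : Type*) [CommRing D] [Algebra C D] : IterativeDerivation C (R ⊗[C] D) where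
  toAlgHom := θ.baseChangeHom D
  coeff_zero' x := by
    induction x with
    | zero => simp
    | add x y hx hy => rw [map_add, map_add, hx, hy]
    | tmul r d =>
      rw [coeff_baseChangeHom_tmul, IterativeDerivation.D, θ.coeff_zero']
  coeff_coeff' i j x := by
    induction x with
    | zero => simp
    | add x y hx hy => simp only [map_add, smul_add, hx, hy]
    | tmul r d =>
      simp only [coeff_baseChangeHom_tmul]
      rw [TensorProduct.smul_tmul']
      exact congrArg (· ⊗ₜ[C] d) (θ.coeff_coeff' i j r)

end Basic

end IterativeDerivation

/-- For an extension `A → B` of `C`-algebras, the algebra `A ⊗ D → B ⊗ D`. -/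
instance (priority := 50) tensorAlgebra (C A B D : Type*) [CommRing C] [CommRing A] [CommRing B]
    [CommRing D] [Algebra C A] [Algebra C B] [Algebra C D] [Algebra A B] [IsScalarTower C A B] :
    Algebra (A ⊗[C] D) (B ⊗[C] D) :=
  (Algebra.TensorProduct.map (IsScalarTower.toAlgHom C A B) (AlgHom.id C D)).toRingHom.toAlgebra

namespace IterativeDerivation

section PicardVessiot

variable {C F R : Type*} [Field C] [Field F] [CommRing R] [Algebra C F] [Algebra C R]

/-- `θ(y) = A y` is an iterative differential equation over `(F, θ)`: one has `A₀ = 1` and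
`(k+l choose l) A_{k+l} = ∑_{i+j=l} θ⁽ⁱ⁾(A_k) A_j`. -/
def IsIDE (θ : IterativeDerivation C F) {n : ℕ} (A : GL (Fin n) F⟦X⟧) : Prop :=
  A.val.map (PowerSeries.coeff 0) = 1 ∧
  ∀ k l : ℕ, (k + l).choose l • A.val.map (PowerSeries.coeff (k + l)) =
    ∑ ij ∈ Finset.HasAntidiagonal.antidiagonal l,
      (A.val.map (PowerSeries.coeff k)).map (θ.D ij.1) * A.val.map (PowerSeries.coeff ij.2)

variable [Algebra F R]

/-- `(R, θR)` is an ID-extension of `(F, θF)`. -/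
def Extends (θF : IterativeDerivation C F) (θR : IterativeDerivation C R) : Prop :=
  ∀ x : F, θR.toAlgHom (algebraMap F R x) = PowerSeries.map (algebraMap F R) (θF.toAlgHom x)

/-- `Y ∈ GL_n(R)` is a fundamental solution matrix: `θ(Y) = A Y`. -/
def IsFundamentalMatrix (θR : IterativeDerivation C R) {n : ℕ} (A : GL (Fin n) F⟦X⟧)
    (Y : GL (Fin n) R) : Prop :=
  Y.val.map θR.toAlgHom =
    A.val.map (PowerSeries.map (algebraMap F R)) * Y.val.map (PowerSeries.C (R := R))

/-- `(R, θR)` is a Picard-Vessiot ring over `(F, θF)` (with field of constants `C`) for the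
iterative differential equation `θ(y) = A y`. -/
structure IsPVRingFor (θF : IterativeDerivation C F) (θR : IterativeDerivation C R) {n : ℕ}
    (A : GL (Fin n) F⟦X⟧) : Prop where
  extends_base : Extends θF θR
  isIDSimple : θR.IsIDSimple
  exists_fundamentalMatrix : ∃ Y : GL (Fin n) R, IsFundamentalMatrix θR A Y ∧
    Algebra.adjoin F (Set.range (fun ij : Fin n × Fin n => Y.val ij.1 ij.2) ∪
      {((Matrix.GeneralLinearGroup.det Y)⁻¹).val}) = ⊤
  constants : θR.ConstantsEqBase

/-- `(R, θR)` is a Picard-Vessiot ring over `(F, θF)` for some iterative differential equation. -/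
def IsPVRing (θF : IterativeDerivation C F) (θR : IterativeDerivation C R) : Prop :=
  ∃ (n : ℕ) (A : GL (Fin n) F⟦X⟧), IsIDE θF A ∧ IsPVRingFor θF θR A

variable (F) [IsScalarTower C F R]

/-- The value at the `C`-algebra `D` of the Galois group functor of `R/F`: the group of all
automorphisms of `R ⊗ D` over `F ⊗ D` which commute with the iterative derivation. -/
def autID (θR : IterativeDerivation C R) (D : Type*) [CommRing D] [Algebra C D] :
    Subgroup ((R ⊗[C] D) ≃ₐ[F ⊗[C] D] (R ⊗[C] D)) where
  carrier := {σ | ∀ i x, (θR.baseChange D).D i (σ x) = σ ((θR.baseChange D).D i x)}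
  mul_mem' {σ τ} hσ hτ i x := by
    rw [AlgEquiv.mul_apply, AlgEquiv.mul_apply, hσ, hτ]
  one_mem' _ _ := rfl
  inv_mem' {σ} hσ i x := by
    apply σ.injective
    rw [← hσ]
    simp only [AlgEquiv.aut_inv, AlgEquiv.apply_symm_apply]

/-- The affine group scheme `Spec H` over `C` (`H` a commutative Hopf algebra over `C`) is the
Galois group scheme of `R/F`: it represents the functor `D ↦ Aut^ID(R ⊗ D / F ⊗ D)`. The group
`(Spec H)(D)` is the set of `C`-algebra homomorphisms `H → D` with the convolution product, and
naturality is expressed by saying that the automorphism attached to `f ∘ g` is the base change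
along `f : D → D'` of the automorphism attached to `g`. -/
structure GaloisGroupScheme (θR : IterativeDerivation C R) (H : Type w) [CommRing H]
    [HopfAlgebra C H] where
  /-- The isomorphism of groups `(Spec H)(D) ≃ Aut^ID(R ⊗ D / F ⊗ D)`. -/
  points : ∀ (D : Type w) [CommRing D] [Algebra C D],
    WithConv (H →ₐ[C] D) ≃* autID F θR D
  natural : ∀ (D D' : Type w) [CommRing D] [Algebra C D] [CommRing D'] [Algebra C D']
    (f : D →ₐ[C] D') (g : WithConv (H →ₐ[C] D)) (x : R ⊗[C] D),
    (points D' (WithConv.toConv (f.comp g.ofConv))).val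
        (Algebra.TensorProduct.map (AlgHom.id C R) f x) =
      Algebra.TensorProduct.map (AlgHom.id C R) f ((points D g).val x)

end PicardVessiot

end IterativeDerivation

end

/-!
Since `E / F` is algebraic, the Picard-Vessiot ring `R` is a field, so `R = E`.

*Fields.* Separable algebraic elements over the constants are constants, because a simple root of a
polynomial lifts uniquely along `R⟦T⟧ → R` (`PowerSeries.ringHom_apply_eq_of_isSeparable`). As `C`
is perfect, it is therefore algebraically closed in `F` and in `R`, and `F ⊗ Cbar`, `R ⊗ Cbar` are
fields (`Algebra.TensorProduct.isField_of_isIntegrallyClosedIn`).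

*Galois.* Separability and finiteness are inherited from `E / F`. For normality, let `σ`, `τ` be two
embeddings of `R` over `F` into an algebraic closure of `E ⊗ Cbar`, and `Y` a fundamental solution
matrix. In `R ⊗[F] R` the matrix `(Y ⊗ 1)⁻¹ (1 ⊗ Y)` consists of constants, and constants of this
finite `R`-algebra are algebraic over `C`
(`IterativeDerivation.ConstantsEqBase.isIntegral_of_map_eq_C`). So `σ(Y)⁻¹ τ(Y)` has entries in
`Cbar`, and `τ(R)` is contained in the field generated by `σ(R)` and `Cbar`
(`IterativeDerivation.IsPVRingFor.algHom_mem`).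

*The group.* The same uniqueness of lifts shows that every automorphism of `R ⊗ Cbar` over
`F ⊗ Cbar` commutes with the iterative derivation (`IterativeDerivation.Extends.autID_eq_top`), so
`Aut^ID` is the whole Galois group.
-/

/-! ### Lifting along power series rings and linear disjointness -/

/-- A simple root of a polynomial lifts in at most one way along `S⟦X⟧ → S`. Hence two homomorphisms
into `S⟦X⟧` which agree on `K` and have the same constant term agree on all elements separable
over `K`. This is what makes iterative derivations extend uniquely to separable extensions. -/
theorem PowerSeries.ringHom_apply_eq_of_isSeparable {K L S : Type*} [CommRing K] [CommRing L]
    [Algebra K L] [CommRing S] [IsDomain S] (φ ψ : L →+* S⟦X⟧)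
    (hK : ∀ a, φ (algebraMap K L a) = ψ (algebraMap K L a)) {x : L} (hx : IsSeparable K x)
    (h0 : PowerSeries.constantCoeff (φ x) = PowerSeries.constantCoeff (ψ x)) : φ x = ψ x := by
  set P := (minpoly K x).map (ψ.comp (algebraMap K L)) with hP
  have hφ : P.eval (φ x) = 0 := by
    have : ψ.comp (algebraMap K L) = φ.comp (algebraMap K L) := RingHom.ext fun a => (hK a).symm
    rw [hP, this, Polynomial.eval_map, ← Polynomial.hom_eval₂, ← Polynomial.aeval_def,
      minpoly.aeval, map_zero]
  have hψ : P.eval (ψ x) = 0 := by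
    rw [hP, Polynomial.eval_map, ← Polynomial.hom_eval₂, ← Polynomial.aeval_def,
      minpoly.aeval, map_zero]
  have hu : IsUnit (P.derivative.eval (ψ x)) := by
    rw [hP, Polynomial.derivative_map, Polynomial.eval_map, ← Polynomial.hom_eval₂,
      ← Polynomial.aeval_def]
    refine IsUnit.map ψ ?_
    obtain ⟨a, b, hab⟩ := hx
    have := congrArg (Polynomial.aeval x) hab
    simp only [map_add, map_mul, minpoly.aeval, mul_zero, zero_add, map_one] at this
    exact IsUnit.of_mul_eq_one_right _ this
  obtain ⟨k, hk⟩ := P.binomExpansion (ψ x) (φ x - ψ x)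
  rw [add_sub_cancel, hφ, hψ, zero_add] at hk
  have hk' : (φ x - ψ x) * (P.derivative.eval (ψ x) + k * (φ x - ψ x)) = 0 := by
    rw [hk]; ring
  rcases mul_eq_zero.1 hk' with h | h
  · exact sub_eq_zero.1 h
  · have h1 := congrArg PowerSeries.constantCoeff h
    rw [map_add, map_mul, map_sub, h0, sub_self, mul_zero, add_zero, map_zero] at h1
    exact absurd h1 (hu.map PowerSeries.constantCoeff).ne_zero

theorem minpoly.eq_map_of_isIntegrallyClosedIn {C A S : Type*} [Field C] [Field A] [CommRing S]
    [IsDomain S] [Algebra C A] [Algebra C S] [Algebra A S] [IsScalarTower C A S]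
    [IsIntegrallyClosedIn C A] {x : S} (hx : IsIntegral C x) :
    minpoly A x = (minpoly C x).map (algebraMap C A) := by
  have hxA : IsIntegral A x := hx.tower_top
  have hdvd : minpoly A x ∣ (minpoly C x).map (algebraMap C A) :=
    minpoly.dvd_map_of_isScalarTower C A x
  have hl : minpoly A x ∈ Polynomial.lifts (algebraMap C A) := by
    rw [Polynomial.lifts_iff_coeff_lifts]
    intro i
    exact IsIntegrallyClosedIn.algebraMap_eq_of_integral
      (Polynomial.isIntegral_coeff_of_dvd _ _ (minpoly.monic hx) (minpoly.monic hxA) hdvd i)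
  obtain ⟨q, hq, hdeg, hmon⟩ := Polynomial.lifts_and_natDegree_eq_and_monic hl (minpoly.monic hxA)
  have hq0 : Polynomial.aeval x q = 0 := by
    rw [← Polynomial.aeval_map_algebraMap A, hq, minpoly.aeval]
  refine (Polynomial.eq_of_monic_of_dvd_of_natDegree_le (minpoly.monic hxA)
    ((minpoly.monic hx).map _) hdvd ?_).symm
  rw [Polynomial.natDegree_map, ← hdeg]
  exact Polynomial.natDegree_le_of_dvd (minpoly.dvd C x hq0) hmon.ne_zero

/-- The power basis of a finite separable subextension of `L` stays linearly independent over `A`,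
because minimal polynomials over `C` stay minimal over `A`. -/
theorem IntermediateField.linearDisjoint_of_isIntegrallyClosedIn {C K : Type*} [Field C]
    [Field K] [Algebra C K] (A L : IntermediateField C K) [IsIntegrallyClosedIn C A]
    [Algebra.IsSeparable C L] : A.LinearDisjoint L := by
  rw [IntermediateField.linearDisjoint_iff']
  have : Algebra.IsIntegral C L.toSubalgebra := inferInstanceAs (Algebra.IsIntegral C L)
  refine Subalgebra.LinearDisjoint.of_linearDisjoint_finite_right _ _ fun B hB _ => ?_
  let B' : IntermediateField C K := B.toIntermediateField'
    (isField_of_isIntegral_of_isField' (R := C) (Field.toIsField C))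
  have hB' : B' ≤ L := hB
  have : FiniteDimensional C B' := inferInstanceAs (Module.Finite C B)
  let := (IntermediateField.inclusion hB').toAlgebra
  have : Algebra.IsSeparable C B' :=
    Algebra.IsSeparable.of_algHom C L (IntermediateField.inclusion hB')
  let pb := Field.powerBasisOfFiniteOfSeparable C B'
  suffices A.LinearDisjoint B' from IntermediateField.linearDisjoint_iff'.1 this
  refine IntermediateField.LinearDisjoint.of_basis_right pb.basis ?_
  have hint : IsIntegral C (pb.gen : K) := (pb.isIntegral_gen).map B'.val
  have hdim : (minpoly A (pb.gen : K)).natDegree = pb.dim := by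
    rw [minpoly.eq_map_of_isIntegrallyClosedIn hint, Polynomial.natDegree_map,
      ← pb.natDegree_minpoly]
    exact congrArg _ (minpoly.algHom_eq B'.val B'.val.injective pb.gen)
  have := (linearIndependent_pow (K := A) (pb.gen : K)).comp (Fin.cast hdim.symm)
    (Fin.cast_injective _)
  have hb : B'.val ∘ pb.basis =
      (fun i : Fin _ => (pb.gen : K) ^ (i : ℕ)) ∘ Fin.cast hdim.symm := by
    ext i
    simp
  rw [hb]
  exact this

theorem Algebra.TensorProduct.isField_of_isIntegrallyClosedIn (C K D : Type*) [Field C]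
    [Field K] [Field D] [Algebra C K] [Algebra C D] [IsIntegrallyClosedIn C K]
    [Algebra.IsSeparable C D] : IsField (K ⊗[C] D) := by
  refine IntermediateField.LinearDisjoint.isField_of_forall C K D fun Ω _ _ fa fb => ?_
  have : IsIntegrallyClosedIn C fa.fieldRange :=
    ((AlgEquiv.ofInjectiveField fa).isIntegrallyClosedIn).1 inferInstance
  have : Algebra.IsSeparable C fb.fieldRange :=
    Algebra.IsSeparable.of_algHom C D (AlgEquiv.ofInjectiveField fb).symm.toAlgHom
  exact IntermediateField.linearDisjoint_of_isIntegrallyClosedIn _ _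

/-- The pushout property of `A ⊗[F] B` for ring homomorphisms into a ring `S` which carries no
preferred `F`-algebra structure. -/
theorem Algebra.TensorProduct.exists_ringHom_of_comp_eq {F A B S : Type*} [CommRing F] [CommRing A]
    [CommRing B] [CommRing S] [Algebra F A] [Algebra F B] (f : A →+* S) (g : B →+* S)
    (h : ∀ x, f (algebraMap F A x) = g (algebraMap F B x)) :
    ∃ Θ : A ⊗[F] B →+* S, (∀ a, Θ (a ⊗ₜ 1) = f a) ∧ ∀ b, Θ (1 ⊗ₜ b) = g b := by
  let : Algebra F S := (f.comp (algebraMap F A)).toAlgebra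
  let f' : A →ₐ[F] S := { f with commutes' := fun _ => rfl }
  let g' : B →ₐ[F] S := { g with commutes' := fun x => (h x).symm }
  refine ⟨(Algebra.TensorProduct.lift f' g' fun _ _ => mul_comm _ _).toRingHom, ?_, ?_⟩
  · intro a
    exact (Algebra.TensorProduct.lift_tmul f' g' _ a 1).trans (by rw [map_one, mul_one]; rfl)
  · intro b
    exact (Algebra.TensorProduct.lift_tmul f' g' _ 1 b).trans (by rw [map_one, one_mul]; rfl)

theorem Normal.of_forall_algHom_mem_range {K L Ω : Type*} [Field K] [Field L] [Field Ω]
    [Algebra K L] [Algebra K Ω] [Algebra L Ω] [IsScalarTower K L Ω] [Algebra.IsAlgebraic K L]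
    [IsAlgClosed Ω] [Algebra.IsAlgebraic K Ω]
    (h : ∀ (τ : L →ₐ[K] Ω) (x : L), τ x ∈ (algebraMap L Ω).range) : Normal K L := by
  let ι := IsScalarTower.toAlgHom K L Ω
  have : IsAlgClosure K Ω := ⟨inferInstance, inferInstance⟩
  have : Normal K Ω := IsAlgClosure.normal K Ω
  have : Normal K ι.fieldRange := by
    rw [IntermediateField.normal_iff_forall_fieldRange_le (L := Ω)]
    rintro σ _ ⟨y, rfl⟩
    let e : L ≃ₐ[K] ι.fieldRange := AlgEquiv.ofInjectiveField ι
    obtain ⟨z, hz⟩ := h (σ.comp e.toAlgHom) (e.symm y)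
    refine ⟨z, hz.trans ?_⟩
    exact congrArg σ (e.apply_symm_apply y)
  let e : L ≃ₐ[K] ι.fieldRange := AlgEquiv.ofInjectiveField ι
  exact Normal.of_algEquiv e.symm

/-! ### Constants of iterative derivations and solution matrices -/

/-- The quotient `Y₁⁻¹ Y₂` of two solutions of `Θ(y) = A y` is fixed by `Θ`. -/
theorem Matrix.map_eq_map_C_of_mul_eq {n : Type*} [Fintype n] [DecidableEq n] {B : Type*}
    [CommRing B] (Θ : B →+* B⟦X⟧) {A : Matrix n n B⟦X⟧} {Y₁ Y₂ Z : Matrix n n B}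
    (hA : IsUnit A) (hY₁ : IsUnit Y₁) (h₁ : Y₁.map Θ = A * Y₁.map (PowerSeries.C (R := B)))
    (h₂ : Y₂.map Θ = A * Y₂.map (PowerSeries.C (R := B))) (hZ : Y₁ * Z = Y₂) :
    Z.map Θ = Z.map (PowerSeries.C (R := B)) := by
  have hu : IsUnit (A * Y₁.map (PowerSeries.C (R := B))) :=
    hA.mul (hY₁.map (PowerSeries.C (R := B)).mapMatrix)
  -- Compare `Θ(Y₁) Θ(Z) = Θ(Y₂)` with `Y₁ Z = Y₂` multiplied by `A`.
  refine hu.mul_left_cancel ?_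
  rw [← h₁, ← Matrix.map_mul, hZ, h₂, h₁, Matrix.mul_assoc, ← Matrix.map_mul, hZ]

namespace IterativeDerivation

/-- Separable elements over the constants are constants, since `θ` and the trivial derivation
agree on `C`. -/
theorem isConstant_of_isSeparable {C R : Type*} [Field C] [CommRing R] [IsDomain R] [Algebra C R]
    (θ : IterativeDerivation C R) {x : R} (hx : IsSeparable C x) : θ.IsConstant x := by
  refine PowerSeries.ringHom_apply_eq_of_isSeparable θ.toAlgHom.toRingHom PowerSeries.C
    (fun a => (θ.toAlgHom.commutes a).trans (PowerSeries.algebraMap_apply ..)) hx ?_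
  rw [PowerSeries.constantCoeff_C, ← PowerSeries.coeff_zero_eq_constantCoeff_apply]
  exact θ.coeff_zero' x

theorem ConstantsEqBase.isIntegrallyClosedIn {C R : Type*} [Field C] [PerfectField C] [CommRing R]
    [IsDomain R] [Algebra C R] {θ : IterativeDerivation C R} (h : θ.ConstantsEqBase) :
    IsIntegrallyClosedIn C R where
  algebraMap_injective := (algebraMap C R).injective
  isIntegral_iff {x} := by
    refine ⟨fun hx => ?_, ?_⟩
    · exact (h x).1 (θ.isConstant_of_isSeparable
        (PerfectField.separable_of_irreducible (minpoly.irreducible hx)))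
    · rintro ⟨y, rfl⟩
      exact isIntegral_algebraMap

/-- Let `Θ` extend `θ` from the field `L` to an `L`-algebra `B`. A constant `z` of `B` which is
integral over `L` is integral over `C`: applying `θ⁽ᵏ⁾`, `k > 0`, to the coefficients of the minimal
polynomial of `z` gives a polynomial of smaller degree that kills `z`, so these coefficients are
constants. -/
theorem ConstantsEqBase.isIntegral_of_map_eq_C {C L B : Type*} [Field C] [Field L] [CommRing B]
    [Algebra C L] [Algebra L B] [Algebra C B] [IsScalarTower C L B] {θ : IterativeDerivation C L}
    (h : θ.ConstantsEqBase) (Θ : B →+* B⟦X⟧)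
    (hΘ : ∀ a, Θ (algebraMap L B a) = PowerSeries.map (algebraMap L B) (θ.toAlgHom a))
    {z : B} (hz : Θ z = PowerSeries.C z) (hint : IsIntegral L z) : IsIntegral C z := by
  set f := minpoly L z with hf
  have hmon : f.Monic := minpoly.monic hint
  have hcoeff : ∀ k, k ≠ 0 → ∀ i, PowerSeries.coeff k (θ.toAlgHom (f.coeff i)) = 0 := by
    intro k hk
    -- The polynomial obtained from `f` by applying `θ⁽ᵏ⁾` to its coefficients.
    let g : Polynomial L := ∑ i ∈ Finset.range f.natDegree,
      Polynomial.monomial i (PowerSeries.coeff k (θ.toAlgHom (f.coeff i)))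
    have hlead : PowerSeries.coeff k (θ.toAlgHom (f.coeff f.natDegree)) = 0 := by
      rw [hmon.coeff_natDegree, map_one, PowerSeries.coeff_one, if_neg hk]
    have hg : Polynomial.aeval z g = 0 := by
      have hzi : ∀ i, Θ (z ^ i) = PowerSeries.C (z ^ i) := fun i => by rw [map_pow, hz, map_pow]
      have h1 : PowerSeries.coeff k (Θ (Polynomial.aeval z f)) = 0 := by
        rw [hf, minpoly.aeval, map_zero, map_zero]
      rw [Polynomial.aeval_eq_sum_range, map_sum, map_sum, Finset.sum_range_succ] at h1
      simp only [Algebra.smul_def, map_mul, hΘ, hzi, PowerSeries.coeff_mul_C,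
        PowerSeries.coeff_map, hlead, map_zero, zero_mul, add_zero] at h1
      rw [map_sum, ← h1]
      simp only [Polynomial.aeval_monomial]
    have hg0 : g = 0 := by
      by_contra hne
      refine (minpoly.degree_le_of_ne_zero L z hne hg).not_gt ?_
      rw [Polynomial.degree_eq_natDegree hmon.ne_zero]
      refine (Polynomial.degree_sum_le _ _).trans_lt ?_
      refine (Finset.sup_lt_iff (WithBot.bot_lt_coe _)).2 fun i hi => ?_
      refine (Polynomial.degree_monomial_le _ _).trans_lt ?_
      exact_mod_cast Finset.mem_range.1 hi
    intro i
    rcases lt_trichotomy i f.natDegree with hi | rfl | hi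
    · have := congrArg (fun q => Polynomial.coeff q i) hg0
      simpa [g, Polynomial.finsetSum_coeff, Polynomial.coeff_monomial, hi] using this
    · exact hlead
    · rw [Polynomial.coeff_eq_zero_of_natDegree_lt hi, map_zero, map_zero]
  have hl : f ∈ Polynomial.lifts (algebraMap C L) := by
    rw [Polynomial.lifts_iff_coeff_lifts]
    intro i
    refine (h _).1 (PowerSeries.ext fun k => ?_)
    rw [PowerSeries.coeff_C]
    split_ifs with hk
    · rw [hk, θ.coeff_zero']
    · exact hcoeff k hk i
  obtain ⟨q, hq, -, hqm⟩ := Polynomial.lifts_and_natDegree_eq_and_monic hl hmon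
  refine ⟨q, hqm, ?_⟩
  rw [← Polynomial.aeval_def, ← Polynomial.aeval_map_algebraMap L, hq, hf, minpoly.aeval]

/-- The two copies of `θR` induce a common extension to `R ⊗[F] R`. -/
theorem Extends.exists_tensor_ringHom {C F R : Type*} [Field C] [Field F] [CommRing R] [Algebra C F]
    [Algebra C R] [Algebra F R] {θF : IterativeDerivation C F} {θR : IterativeDerivation C R}
    (h : Extends θF θR) :
    ∃ Θ : R ⊗[F] R →+* (R ⊗[F] R)⟦X⟧,
      (∀ r, Θ (r ⊗ₜ 1) = PowerSeries.map
        (Algebra.TensorProduct.includeLeft : R →ₐ[F] R ⊗[F] R).toRingHom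
        (θR.toAlgHom r)) ∧
      ∀ r, Θ (1 ⊗ₜ r) = PowerSeries.map
        (Algebra.TensorProduct.includeRight : R →ₐ[F] R ⊗[F] R).toRingHom (θR.toAlgHom r) := by
  refine Algebra.TensorProduct.exists_ringHom_of_comp_eq
    ((PowerSeries.map (Algebra.TensorProduct.includeLeft : R →ₐ[F] R ⊗[F] R).toRingHom).comp
      θR.toAlgHom.toRingHom)
    ((PowerSeries.map (Algebra.TensorProduct.includeRight : R →ₐ[F] R ⊗[F] R).toRingHom).comp
      θR.toAlgHom.toRingHom) fun x => ?_
  simp only [RingHom.comp_apply, AlgHom.toRingHom_eq_coe, RingHom.coe_coe, h x]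
  ext k
  simp [Algebra.TensorProduct.algebraMap_apply, Algebra.TensorProduct.tmul_one_eq_one_tmul]

/-- Two embeddings `σ`, `τ` of a Picard-Vessiot field into `Ω` differ by the matrix `σ(Y)⁻¹ τ(Y)`,
the image of a matrix of constants of `R ⊗[F] R`, whose entries are algebraic over `C`. So a
subfield that contains `σ(R)` and all elements algebraic over `C` contains `τ(R)`. -/
theorem IsPVRingFor.algHom_mem {C F R Ω : Type*} [Field C] [Field F] [Field R] [Field Ω]
    [Algebra C F] [Algebra C R] [Algebra F R] [IsScalarTower C F R] [Algebra C Ω] [Algebra F Ω]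
    [IsScalarTower C F Ω]
    {θF : IterativeDerivation C F} {θR : IterativeDerivation C R} {n : ℕ}
    {A : GL (Fin n) F⟦X⟧} (h : IsPVRingFor θF θR A) [Algebra.IsAlgebraic F R]
    (S : IntermediateField F Ω) (hS : ∀ x : Ω, IsIntegral C x → x ∈ S)
    (σ τ : R →ₐ[F] Ω) (hσ : ∀ r, σ r ∈ S) (r : R) : τ r ∈ S := by
  obtain ⟨Y, hY, hgen⟩ := h.exists_fundamentalMatrix
  obtain ⟨Θ, hΘl, hΘr⟩ := h.extends_base.exists_tensor_ringHom
  let il : R →ₐ[F] R ⊗[F] R := Algebra.TensorProduct.includeLeft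
  let ir : R →ₐ[F] R ⊗[F] R := Algebra.TensorProduct.includeRight
  let m : R ⊗[F] R →ₐ[F] Ω := Algebra.TensorProduct.lift σ τ fun _ _ => mul_comm _ _
  have hml : ∀ r, m (il r) = σ r := fun r =>
    (Algebra.TensorProduct.lift_tmul σ τ _ r 1).trans (by rw [map_one, mul_one])
  have hmr : ∀ r, m (ir r) = τ r := fun r =>
    (Algebra.TensorProduct.lift_tmul σ τ _ 1 r).trans (by rw [map_one, one_mul])
  let AB : Matrix (Fin n) (Fin n) (R ⊗[F] R)⟦X⟧ :=
    A.val.map (PowerSeries.map (algebraMap F (R ⊗[F] R)))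
  have hAB : IsUnit AB := A.isUnit.map (PowerSeries.map (algebraMap F (R ⊗[F] R))).mapMatrix
  -- Both copies of `Y` in `R ⊗[F] R` solve the same equation, because `A` has entries in `F⟦T⟧`.
  have key : ∀ i : R →ₐ[F] R ⊗[F] R,
      (∀ r, Θ (i r) = PowerSeries.map i.toRingHom (θR.toAlgHom r)) →
      (Y.val.map i).map Θ = AB * (Y.val.map i).map (PowerSeries.C (R := R ⊗[F] R)) := by
    intro i hi
    have := congrArg (fun M => M.map (PowerSeries.map i.toRingHom)) hY
    simp only [Matrix.map_mul, Matrix.map_map] at this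
    convert this using 1
    · ext a b
      simp [hi]
    · congr 1
      · ext a b k
        simp only [AB, Matrix.map_apply, Function.comp_apply]
        simp
      · ext a b k
        simp
  -- `Z = (Y ⊗ 1)⁻¹ (1 ⊗ Y)` has constant entries and is mapped by `m` to `σ(Y)⁻¹ τ(Y)`.
  let Z : Matrix (Fin n) (Fin n) (R ⊗[F] R) := (Y⁻¹).val.map il * Y.val.map ir
  have hYl : Y.val.map il * (Y⁻¹).val.map il = 1 := by
    rw [← Matrix.map_mul, ← Units.val_mul, mul_inv_cancel]
    exact Matrix.map_one il (map_zero il) (map_one il)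
  have hYZ : Y.val.map il * Z = Y.val.map ir := by
    rw [← Matrix.mul_assoc, hYl, Matrix.one_mul]
  have hZ := Matrix.map_eq_map_C_of_mul_eq Θ hAB
    (Y.isUnit.map (il.toRingHom.mapMatrix)) (key il hΘl) (key ir hΘr) hYZ
  have hZint : ∀ a b, m (Z a b) ∈ S := by
    intro a b
    refine hS _ ?_
    have : IsIntegral C (Z a b) := by
      refine h.constants.isIntegral_of_map_eq_C Θ hΘl
        (congrFun (congrFun hZ a) b) ?_
      have : Algebra.IsIntegral R (R ⊗[F] R) := inferInstance
      exact this.isIntegral _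
    exact this.map (m.restrictScalars C)
  have hτY : ∀ a b, τ (Y.val a b) ∈ S := by
    intro a b
    have := congrArg m (congrFun (congrFun hYZ a) b)
    rw [Matrix.map_apply, hmr, Matrix.mul_apply, map_sum] at this
    rw [← this]
    refine sum_mem fun c _ => ?_
    rw [map_mul, Matrix.map_apply, hml]
    exact mul_mem (hσ _) (hZint _ _)
  have hle : Algebra.adjoin F (Set.range (fun ij : Fin n × Fin n => Y.val ij.1 ij.2) ∪
      {((Matrix.GeneralLinearGroup.det Y)⁻¹).val}) ≤ S.toSubalgebra.comap τ := by
    refine Algebra.adjoin_le ?_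
    rintro _ (⟨ij, rfl⟩ | rfl)
    · exact hτY _ _
    · change τ _ ∈ S
      rw [Units.val_inv_eq_inv_val, map_inv₀]
      refine inv_mem ?_
      change τ (Y.val.det) ∈ S
      rw [AlgHom.map_det, Matrix.det_apply]
      refine sum_mem fun _ _ => ?_
      rw [Units.smul_def]
      refine zsmul_mem (prod_mem fun _ _ => ?_) _
      exact hτY _ _
  rw [hgen] at hle
  exact hle (Algebra.mem_top (x := r))

end IterativeDerivation

/-! ### The extension `F ⊗ D → K ⊗ D` -/

section TensorAlgebra

variable {C F K D : Type*} [CommRing C] [CommRing F] [CommRing K] [CommRing D] [Algebra C F]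
  [Algebra C K] [Algebra C D] [Algebra F K] [IsScalarTower C F K]

theorem tensorAlgebra_algebraMap_tmul (f : F) (d : D) :
    algebraMap (F ⊗[C] D) (K ⊗[C] D) (f ⊗ₜ d) = algebraMap F K f ⊗ₜ d := rfl

instance tensorAlgebra.isScalarTower_left : IsScalarTower F (F ⊗[C] D) (K ⊗[C] D) :=
  IsScalarTower.of_algebraMap_eq fun _ => rfl

/-- For a bijective extension `K → L` over `F`, the induced isomorphism `K ⊗ D ≃ L ⊗ D` over
`F ⊗ D`. -/
noncomputable def tensorAlgebraEquiv (L : Type*) [CommRing L] [Algebra C L] [Algebra F L]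
    [Algebra K L] [IsScalarTower C F L] [IsScalarTower C K L] [IsScalarTower F K L]
    (h : Function.Bijective (algebraMap K L)) : (K ⊗[C] D) ≃ₐ[F ⊗[C] D] (L ⊗[C] D) :=
  AlgEquiv.ofBijective
    { algebraMap (K ⊗[C] D) (L ⊗[C] D) with
      commutes' := fun x => by
        change algebraMap (K ⊗[C] D) (L ⊗[C] D) (algebraMap (F ⊗[C] D) (K ⊗[C] D) x) =
          algebraMap (F ⊗[C] D) (L ⊗[C] D) x
        induction x with
        | zero => simp only [map_zero]
        | add x y hx hy => simp only [map_add, hx, hy]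
        | tmul f d =>
          simp only [tensorAlgebra_algebraMap_tmul, ← IsScalarTower.algebraMap_apply] }
    (Algebra.TensorProduct.congr (AlgEquiv.ofBijective (IsScalarTower.toAlgHom C K L) h)
      (AlgEquiv.refl : D ≃ₐ[C] D)).bijective

theorem tensorAlgebraEquiv_apply (L : Type*) [CommRing L] [Algebra C L] [Algebra F L]
    [Algebra K L] [IsScalarTower C F L] [IsScalarTower C K L] [IsScalarTower F K L]
    (h : Function.Bijective (algebraMap K L)) (x : K ⊗[C] D) :
    tensorAlgebraEquiv (F := F) L h x = algebraMap (K ⊗[C] D) (L ⊗[C] D) x := rfl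

theorem tensorAlgebra_adjoin_range_includeLeft :
    Algebra.adjoin (F ⊗[C] D)
      (Set.range (Algebra.TensorProduct.includeLeft : K →ₐ[C] K ⊗[C] D)) = ⊤ := by
  refine eq_top_iff.2 fun x _ => ?_
  induction x with
  | zero => exact zero_mem _
  | add x y hx hy => exact add_mem (hx trivial) (hy trivial)
  | tmul k d =>
    have : k ⊗ₜ[C] d = (k ⊗ₜ 1) * algebraMap (F ⊗[C] D) (K ⊗[C] D) (1 ⊗ₜ d) := by
      simp [tensorAlgebra_algebraMap_tmul]
    rw [this]
    exact mul_mem (Algebra.subset_adjoin ⟨k, rfl⟩) (Subalgebra.algebraMap_mem _ _)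

instance tensorAlgebra.finite [Module.Finite F K] : Module.Finite (F ⊗[C] D) (K ⊗[C] D) := by
  obtain ⟨s, hs⟩ := Module.Finite.fg_top (R := F) (M := K)
  classical
  refine ⟨s.image fun k => k ⊗ₜ 1, eq_top_iff.2 fun x _ => ?_⟩
  induction x with
  | zero => exact zero_mem _
  | add x y hx hy => exact add_mem (hx trivial) (hy trivial)
  | tmul k d =>
    clear * - hs
    have hk : k ∈ Submodule.span F (s : Set K) := hs ▸ Submodule.mem_top
    induction hk using Submodule.span_induction with
    | zero => rw [TensorProduct.zero_tmul]; exact zero_mem _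
    | add x y _ _ hx hy => rw [TensorProduct.add_tmul]; exact add_mem hx hy
    | smul a x _ hx =>
      have : (a • x) ⊗ₜ[C] d = (a ⊗ₜ[C] (1 : D)) • (x ⊗ₜ[C] d) := by
        rw [Algebra.smul_def, Algebra.smul_def, tensorAlgebra_algebraMap_tmul,
          Algebra.TensorProduct.tmul_mul_tmul, one_mul]
      rw [this]
      exact Submodule.smul_mem _ _ hx
    | mem x hx =>
      have : x ⊗ₜ[C] d = ((1 : F) ⊗ₜ[C] d) • (x ⊗ₜ[C] (1 : D)) := by
        rw [Algebra.smul_def, tensorAlgebra_algebraMap_tmul,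
          Algebra.TensorProduct.tmul_mul_tmul, map_one, one_mul, mul_one]
      rw [this]
      exact Submodule.smul_mem _ _ (Submodule.subset_span (by simpa using ⟨x, hx, rfl⟩))

end TensorAlgebra

/-! ### Galois theory of `R ⊗ Cbar` over `F ⊗ Cbar` -/

theorem Algebra.IsSeparable.of_adjoin_range {F K M L : Type*} [Field F] [CommRing K] [Field M]
    [Field L] [Algebra F K] [Algebra F M] [Algebra F L] [Algebra M L] [IsScalarTower F M L]
    [Algebra.IsSeparable F K] (i : K →ₐ[F] L) (h : Algebra.adjoin M (Set.range i) = ⊤) :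
    Algebra.IsSeparable M L := by
  have hle : Algebra.adjoin M (Set.range i) ≤ (separableClosure M L).toSubalgebra := by
    refine Algebra.adjoin_le ?_
    rintro _ ⟨k, rfl⟩
    have hk : (minpoly F k).Separable := Algebra.IsSeparable.isSeparable F k
    refine (hk.map (f := algebraMap F M)).of_dvd (minpoly.dvd _ _ ?_)
    rw [Polynomial.aeval_map_algebraMap, Polynomial.aeval_algHom_apply, minpoly.aeval, map_zero]
  rw [h] at hle
  exact ⟨fun x => mem_separableClosure_iff.1 (hle Algebra.mem_top)⟩

theorem IsAlgClosed.mem_range_of_isIntegral {C D Ω : Type*} [Field C] [Field D] [IsAlgClosed D]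
    [CommRing Ω] [IsDomain Ω] [Algebra C D] [Algebra C Ω] (j : D →ₐ[C] Ω) {x : Ω}
    (hx : IsIntegral C x) : x ∈ j.range := by
  let := j.toAlgebra
  have : IsScalarTower C D Ω := IsScalarTower.of_algebraMap_eq fun c => (j.commutes c).symm
  have hxD : IsIntegral D x := hx.tower_top
  exact minpoly.mem_range_of_degree_eq_one D x
    (IsAlgClosed.degree_eq_one_of_irreducible D (minpoly.irreducible hxD))

namespace IterativeDerivation

/-- Normality is the step that needs a fundamental solution matrix: an `M`-embedding `τ` of `L`
into an algebraic closure maps `R` into `L`, since `L` contains the algebraically closed field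
`D ⊇ C`. -/
theorem IsPVRing.isGalois_of_adjoin_range {C F R D M L : Type*} [Field C] [Field F] [Field R]
    [Field D] [Field M] [Field L] [Algebra C F] [Algebra C R] [Algebra F R] [IsScalarTower C F R]
    [Algebra C D] [IsAlgClosed D] [Algebra F M] [Algebra M L] [Algebra F L] [IsScalarTower F M L]
    [Algebra C M] [IsScalarTower C F M]
    {θF : IterativeDerivation C F} {θR : IterativeDerivation C R} (h : IsPVRing θF θR)
    [Algebra.IsSeparable F R] (j : D →ₐ[C] M) (i : R →ₐ[F] L)
    (hi : Algebra.adjoin M (Set.range i) = ⊤) : IsGalois M L := by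
  obtain ⟨n, A, -, hA⟩ := h
  have hsep : Algebra.IsSeparable M L := Algebra.IsSeparable.of_adjoin_range i hi
  let Ω := AlgebraicClosure L
  let _ : Algebra C L := ((algebraMap M L).comp (algebraMap C M)).toAlgebra
  have : IsScalarTower C M L := IsScalarTower.of_algebraMap_eq fun _ => rfl
  have : IsScalarTower C F L := IsScalarTower.of_algebraMap_eq fun c => by
    rw [IsScalarTower.algebraMap_apply C M L, IsScalarTower.algebraMap_apply C F M,
      ← IsScalarTower.algebraMap_apply F M L]
  have : Algebra.IsAlgebraic M Ω := Algebra.IsAlgebraic.trans M L Ω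
  have : IsScalarTower C F Ω := IsScalarTower.of_algebraMap_eq fun c => by
    rw [IsScalarTower.algebraMap_apply C L Ω, IsScalarTower.algebraMap_apply C F L,
      ← IsScalarTower.algebraMap_apply F L Ω]
  let ι : L →ₐ[F] Ω := IsScalarTower.toAlgHom F L Ω
  have hnormal : Normal M L := by
    refine Normal.of_forall_algHom_mem_range (Ω := Ω) fun τ x => ?_
    have hle : Algebra.adjoin M (Set.range i) ≤ (IsScalarTower.toAlgHom M L Ω).range.comap τ := by
      refine Algebra.adjoin_le ?_
      rintro _ ⟨r, rfl⟩
      refine hA.algHom_mem ι.fieldRange (fun y hy => ?_) (ι.comp i)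
        ((τ.restrictScalars F).comp i) (fun r => ⟨i r, rfl⟩) r
      obtain ⟨d, rfl⟩ := IsAlgClosed.mem_range_of_isIntegral
        ((IsScalarTower.toAlgHom C L Ω).comp ((IsScalarTower.toAlgHom C M L).comp j)) hy
      exact ⟨algebraMap M L (j d), rfl⟩
    rw [hi] at hle
    exact hle (Algebra.mem_top (x := x))
  exact { }

variable {C F R D : Type*} [Field C] [Field F] [CommRing R] [CommRing D] [Algebra C F]
  [Algebra C R] [Algebra F R] [Algebra C D] {θF : IterativeDerivation C F}
  {θR : IterativeDerivation C R}

theorem Extends.baseChange_D_algebraMap [IsScalarTower C F R] (h : Extends θF θR) (k : ℕ)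
    (y : F ⊗[C] D) :
    (θR.baseChange D).D k (algebraMap (F ⊗[C] D) (R ⊗[C] D) y) =
      algebraMap (F ⊗[C] D) (R ⊗[C] D) ((θF.baseChange D).D k y) := by
  induction y with
  | zero => simp [IterativeDerivation.D]
  | add x y hx hy => simp only [IterativeDerivation.D, map_add] at hx hy ⊢; rw [hx, hy]
  | tmul f d =>
    have h1 := θR.coeff_baseChangeHom_tmul D k (algebraMap F R f) d
    have h2 := θF.coeff_baseChangeHom_tmul D k f d
    rw [IterativeDerivation.D, h f, PowerSeries.coeff_map] at h1
    rw [tensorAlgebra_algebraMap_tmul]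
    refine h1.trans ?_
    exact (congrArg (algebraMap (F ⊗[C] D) (R ⊗[C] D)) h2).symm

/-- Every automorphism of `R ⊗ D` over `F ⊗ D` commutes with the iterative derivation, by uniqueness
of the extension of a derivation to separable elements. -/
theorem Extends.autID_eq_top [IsScalarTower C F R] [IsDomain (R ⊗[C] D)] (h : Extends θF θR)
    (hsep : ∀ x : R ⊗[C] D, IsSeparable (F ⊗[C] D) x) : autID F θR D = ⊤ := by
  refine eq_top_iff.2 fun σ _ k x => ?_
  have := PowerSeries.ringHom_apply_eq_of_isSeparable
    ((θR.baseChange D).toAlgHom.toRingHom.comp (σ : R ⊗[C] D →+* R ⊗[C] D))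
    ((PowerSeries.map (σ : R ⊗[C] D →+* R ⊗[C] D)).comp (θR.baseChange D).toAlgHom.toRingHom)
    (fun a => ?_) (hsep x) ?_
  · have := congrArg (PowerSeries.coeff k) this
    simpa [IterativeDerivation.D] using this
  · ext k
    have := h.baseChange_D_algebraMap (D := D) k a
    rw [IterativeDerivation.D] at this
    simp [this]
  · simp only [← PowerSeries.coeff_zero_eq_constantCoeff_apply, RingHom.comp_apply,
      PowerSeries.coeff_map, AlgHom.toRingHom_eq_coe, RingHom.coe_coe]
    exact ((θR.baseChange D).coeff_zero' (σ x)).trans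
      (congrArg σ ((θR.baseChange D).coeff_zero' x)).symm

end IterativeDerivation

theorem mainTheorem5
    {C F R E : Type*} {Cbar : Type w}
    (p : ℕ) [Fact p.Prime]
    [Field C] [PerfectField C]
    [Field F] [CharP F p] [Algebra C F]
    [CommRing R] [Algebra C R] [Algebra F R] [IsScalarTower C F R]
    [Field E] [Algebra C E] [Algebra F E] [Algebra R E]
    [IsScalarTower C F E] [IsScalarTower C R E] [IsScalarTower F R E]
    [Field Cbar] [Algebra C Cbar] [IsAlgClosure C Cbar]
    -- the base ID-field, with field of constants `C`
    (θF : IterativeDerivation C F) (hC : θF.ConstantsEqBase) (hnd : θF.NonDegenerate)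
    -- the PV-ring `R` with PV-field `E = Quot(R)`, finite separable over `F`
    (θR : IterativeDerivation C R) (hPV : IterativeDerivation.IsPVRing θF θR)
    [IsFractionRing R E] [FiniteDimensional F E] [Algebra.IsSeparable F E] :
    ∃ (hF : IsField (F ⊗[C] Cbar)) (hE : IsField (E ⊗[C] Cbar)),
      -- `E_Cbar / F_Cbar` is a finite Galois extension of fields
      (letI := hF.toField
       letI := hE.toField
       FiniteDimensional (F ⊗[C] Cbar) (E ⊗[C] Cbar) ∧
         IsGalois (F ⊗[C] Cbar) (E ⊗[C] Cbar)) ∧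
      -- the canonical action identifies the group `Aut^ID(R_Cbar / F_Cbar)` of `Cbar`-points of
      -- the Galois group functor with the Galois group
      (∃ Φ : IterativeDerivation.autID F θR Cbar ≃*
          ((E ⊗[C] Cbar) ≃ₐ[F ⊗[C] Cbar] (E ⊗[C] Cbar)),
        ∀ σ x, Φ σ (algebraMap (R ⊗[C] Cbar) (E ⊗[C] Cbar) x) =
          algebraMap (R ⊗[C] Cbar) (E ⊗[C] Cbar) (σ.val x)) ∧
      -- the same for the `Cbar`-points of the Galois group scheme `Spec H`
      (∀ (H : Type w) [CommRing H] [HopfAlgebra C H]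
          (G : IterativeDerivation.GaloisGroupScheme F θR H),
        ∃ Ψ : WithConv (H →ₐ[C] Cbar) ≃*
            ((E ⊗[C] Cbar) ≃ₐ[F ⊗[C] Cbar] (E ⊗[C] Cbar)),
          ∀ g x, Ψ g (algebraMap (R ⊗[C] Cbar) (E ⊗[C] Cbar) x) =
            algebraMap (R ⊗[C] Cbar) (E ⊗[C] Cbar) ((G.points Cbar g).val x)) := by
  have hinjRE : Function.Injective (algebraMap R E) := IsFractionRing.injective R E
  have : IsDomain R := hinjRE.isDomain (algebraMap R E)
  let a : R →ₐ[F] E := IsScalarTower.toAlgHom F R E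
  have : FiniteDimensional F R := FiniteDimensional.of_injective a.toLinearMap hinjRE
  have : Algebra.IsSeparable F R := ⟨fun x => by
    rw [IsSeparable, ← minpoly.algHom_eq a hinjRE]
    exact Algebra.IsSeparable.isSeparable F (a x)⟩
  -- A domain that is algebraic over `F` is a field.
  have hRfield : IsField R := isField_of_isIntegral_of_isField' (R := F) (Field.toIsField F)
  -- As `R` is a field, it coincides with its field of fractions `E`.
  have hbij : Function.Bijective (algebraMap R E) :=
    IsField.localization_map_bijective (M := nonZeroDivisors R) (Rₘ := E) (by simp) hRfield
  have : IsAlgClosed Cbar := IsAlgClosure.isAlgClosed C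
  have hF : IsField (F ⊗[C] Cbar) := by
    have := hC.isIntegrallyClosedIn
    exact Algebra.TensorProduct.isField_of_isIntegrallyClosedIn C F Cbar
  have hRt : IsField (R ⊗[C] Cbar) := by
    obtain ⟨n, A, -, hA⟩ := hPV
    have := hA.constants.isIntegrallyClosedIn
    let := hRfield.toField
    exact Algebra.TensorProduct.isField_of_isIntegrallyClosedIn C R Cbar
  let ea : (R ⊗[C] Cbar) ≃ₐ[F ⊗[C] Cbar] (E ⊗[C] Cbar) :=
    tensorAlgebraEquiv E hbij
  have hE : IsField (E ⊗[C] Cbar) := ea.symm.toMulEquiv.isField hRt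
  have htop : IterativeDerivation.autID F θR Cbar = ⊤ := by
    have : IsDomain (R ⊗[C] Cbar) := hRt.isDomain
    obtain ⟨n, A, -, hA⟩ := hPV
    refine hA.extends_base.autID_eq_top ?_
    let := hF.toField
    let := hRt.toField
    have := Algebra.IsSeparable.of_adjoin_range (M := F ⊗[C] Cbar)
      (Algebra.TensorProduct.includeLeft : R →ₐ[F] R ⊗[C] Cbar)
      tensorAlgebra_adjoin_range_includeLeft
    exact this.isSeparable
  let Φ : IterativeDerivation.autID F θR Cbar ≃*
      ((E ⊗[C] Cbar) ≃ₐ[F ⊗[C] Cbar] (E ⊗[C] Cbar)) :=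
    ((MulEquiv.subgroupCongr htop).trans Subgroup.topEquiv).trans (AlgEquiv.autCongr ea)
  have hΦ : ∀ σ x, Φ σ (algebraMap (R ⊗[C] Cbar) (E ⊗[C] Cbar) x) =
      algebraMap (R ⊗[C] Cbar) (E ⊗[C] Cbar) (σ.val x) := by
    intro σ x
    simp only [← tensorAlgebraEquiv_apply (F := F) (C := C) (D := Cbar) E hbij]
    exact congrArg (fun y => ea (σ.val y)) (ea.symm_apply_apply x)
  refine ⟨hF, hE, ⟨tensorAlgebra.finite, ?_⟩, ⟨Φ, hΦ⟩, fun H _ _ G =>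
    ⟨(G.points Cbar).trans Φ, fun g x => hΦ _ x⟩⟩
  let := hRfield.toField
  let := hF.toField
  let := hE.toField
  exact hPV.isGalois_of_adjoin_range
    (Algebra.TensorProduct.includeRight : Cbar →ₐ[C] F ⊗[C] Cbar)
    ((Algebra.TensorProduct.includeLeft : E →ₐ[F] E ⊗[C] Cbar).comp a) (by
      rw [← tensorAlgebra_adjoin_range_includeLeft, AlgHom.coe_comp,
        Function.Surjective.range_comp (f := a) hbij.2]
      rfl)
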